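/- Let $N,T\ge 1$, $[T]=\{1,\dots,T\}$. Each agent $n\in[N]$ has data $E_n\in\mathbb R$, $\underline x_n,\overline x_n\in\mathbb R^T$ with $$\mathcal X_n=\Big\{x_n\in\mathbb R^T:\ \sum_{t}x_{n,t}=E_n,\ \ \underline x_{n,t}\le x_{n,t}\le\overline x_{n,t}\ \ \forall t\Big\}\neq\emptyset .$$ Let $\mathcal P\subset\mathbb R^T$ be such that every $p\in\mathcal P$ satisfies $\sum_t p_t=\sum_n E_n$ and $\sum_n\underline x_{n,t}\le p_t\le\sum_n\overline x_{n,t}$ for all $t$, and let $f:\mathbb R^T\to\mathbb R$. **Alternate projections.** For $p\in\mathcal P$ and $y^{(0)}\in\mathbb R^{NT}$ put, for $k\ge1$, $x_n^{(k)}=P_{\mathcal X_n}(y_n^{(k-1)})$ (Euclidean projection), $\nu^{(k)}=\frac1N\big(p-\sum_n x^{(k)}_n\big)$ and $y^{(k)}_n=x^{(k)}_n+\nu^{(k)}$; let $\nu^\infty=\lim_k\nu^{(k)}$. A number $\rho\in(0,1)$ is called a convergence factor if $\|x^{(k+1)}-x^{(k)}\|_2\le\rho\,\|x^{(k)}-x^{(k-1)}\|_2$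 for all $k\ge2$, $p\in\mathcal P$ and $y^{(0)}$. **NI-APM** (input $p$, $y^{(0)}$; parameters: a norm $\|\cdot\|$ on $\mathbb R^{NT}$, $B$, $\varepsilon_{\rm dis}>0$, $\varepsilon_{\rm cvg}>0$). Set $\varepsilon=\varepsilon_{\rm cvg}$ and compute the iterates one after the other. Whenever, after iterate $k\ge2$, $\|x^{(k)}-x^{(k-1)}\|<\varepsilon$: if $\|x^{(k)}-y^{(k)}\|\le\varepsilon_{\rm dis}$, return "True" and $x^{(k)}$; otherwise put $\mathcal T=\{t: B\varepsilon<\nu^{(k)}_t\}$ and $A_{\mathcal T}=\sum_{t\in\mathcal T}\sum_n x^{(k)}_{n,t}$; if $A_{\mathcal T}<\sum_{t\in\mathcal T}p_t$, return "False" and $(\mathcal T,A_{\mathcal T})$; otherwise replace $\varepsilon$ by $\varepsilon/2$ and go on with iterate $k+1$. **Optimal disaggregation algorithm.** Start with $\mathcal P^{(0)}=\mathcal P$. In iteration $s$: if $\mathcal P^{(s)}=\emptyset$, stop; otherwise take a minimizer $p^{(s)}$ of $f$ on $\mathcal P^{(s)}$ and run NI-APM on $p^{(s)}$ (from any starting point).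 If it returns True, stop; if it returns False with $(\mathcal T^{(s)},A^{(s)})$, put $\mathcal P^{(s+1)}=\mathcal P^{(s)}\cap\{p:\sum_{t\in\mathcal T^{(s)}}p_t\le A^{(s)}\}$ (a cut is added to the master problem) and go to iteration $s+1$. The minimizer and the starting point are given by fixed rules depending on the list of cuts added so far; for every finite list of cuts for which the master problem $\min f$ over the points of $\mathcal P$ satisfying these cuts is feasible, a minimizer exists and the rule selects one. **Proposition.** A convergence factor $\rho\in(0,1)$ exists. Let $\rho\in(0,1)$ be any convergence factor, let $\kappa$ be such that $\|z\|_2\le\kappa\|z\|$ for all $z\in\mathbb R^{NT}$ ($\kappa=1$ for the Euclidean norm), and let $B>\frac{\kappa}{1-\rho}$ and $\varepsilon_{\rm dis}>0$. Consider the condition $$(\ast)\qquad 2B\,\varepsilon_{\rm cvg}<|\nu^\infty_t|\quad\text{for all } t \text{ with } \nu^\infty_t\ne0,\ \text{ at every allocation } p^{(s)} \text{ met by the algorithm.}$$ Then $(\ast)$ holds for all sufficiently small $\varepsilon_{\rm cvg}>0$. Whenever $\varepsilon_{\rm cvg}>0$ satisfies $(\ast)$, the optimal disaggregation algorithm stops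 after finitely many iterations (every call of NI-APM returning after finitely many steps); the sets $\mathcal T^{(s)}$ of the cuts that it adds are pairwise distinct, nonempty and different from $[T]$, so that at most $2^T-2$ cuts are added to the master problem. -/

import Mathlib

open Filter Topology

namespace Disaggregation

noncomputable section

/-- An aggregate allocation `p = (p_t)` of the `T` resources. -/
abbrev Alloc (T : ℕ) : Type := Fin T → ℝ

/-- The profile of one agent, in `ℝ^T` with its Euclidean norm. -/
abbrev AgentProfile (T : ℕ) : Type := EuclideanSpace ℝ (Fin T)

/-- A family `(x_n)` of agents' profiles, in `ℝ^{NT}` with its Euclidean norm. -/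
abbrev Profile (N T : ℕ) : Type := PiLp 2 (fun _ : Fin N => AgentProfile T)

/-- The private data of the agents: demands `E_n` and bounds on the individual profiles. -/
structure Agents (N T : ℕ) where
  demand : Fin N → ℝ
  lower : Fin N → Fin T → ℝ
  upper : Fin N → Fin T → ℝ

/-- The individual feasibility set `X_n`. -/
def Agents.feasible {N T : ℕ} (A : Agents N T) (n : Fin N) : Set (AgentProfile T) :=
  {x | ∑ t, x t = A.demand n ∧ ∀ t, A.lower n t ≤ x t ∧ x t ≤ A.upper n t}

/-- The aggregate conditions on an allocation obtained by summing the individual constraints. -/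
def Agents.AggregateCond {N T : ℕ} (A : Agents N T) (p : Alloc T) : Prop :=
  ∑ t, p t = ∑ n, A.demand n ∧
    ∀ t, ∑ n, A.lower n t ≤ p t ∧ p t ≤ ∑ n, A.upper n t

/-- The Euclidean projection of `y` on `C`: a nearest point of `C`
(it exists and is unique when `C` is nonempty, closed and convex). -/
def euclProj {F : Type*} [NormedAddCommGroup F] (C : Set F) (y : F) : F :=
  Classical.epsilon fun x => x ∈ C ∧ ∀ z ∈ C, ‖y - x‖ ≤ ‖y - z‖

/-- Every agent projects her part of the profile on her own feasibility set. -/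
def Agents.proj {N T : ℕ} (A : Agents N T) (y : Profile N T) : Profile N T :=
  WithLp.toLp 2 fun n => euclProj (A.feasible n) (y n)

/-- The aggregate `S = ∑_n x_n` (the value computed by the secure summation protocol). -/
def aggregate {N T : ℕ} (x : Profile N T) (t : Fin T) : ℝ := ∑ n, x n t

/-- The vector `ν = (p - S) / N` that the operator sends to the agents. -/
def nu {N T : ℕ} (p : Alloc T) (x : Profile N T) (t : Fin T) : ℝ :=
  (p t - aggregate x t) / N

/-- The update `y_n = x_n + ν`, the projection on the profiles that aggregate to `p`. -/
def shift {N T : ℕ} (p : Alloc T) (x : Profile N T) : Profile N T :=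
  WithLp.toLp 2 fun n => WithLp.toLp 2 fun t => x n t + nu p x t

/-- The iterates `y^(k)` of the alternate projections method started at `y^(0) = y₀`. -/
def apmY {N T : ℕ} (A : Agents N T) (p : Alloc T) (y₀ : Profile N T) : ℕ → Profile N T
  | 0 => y₀
  | k + 1 => shift p (A.proj (apmY A p y₀ k))

/-- The iterates `x^(k) = P_X(y^(k-1))`, `k ≥ 1`, of the alternate projections method.
There is no iterate `x^(0)`; the value at `0` is never used. -/
def apmX {N T : ℕ} (A : Agents N T) (p : Alloc T) (y₀ : Profile N T) : ℕ → Profile N T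
  | 0 => y₀
  | k + 1 => A.proj (apmY A p y₀ k)

/-- `ρ` is a geometric convergence factor of the alternate projections method, for all
allocations of `P` and all starting points. -/
def IsAPMRate {N T : ℕ} (A : Agents N T) (P : Set (Alloc T)) (ρ : ℝ) : Prop :=
  ∀ p ∈ P, ∀ y₀ : Profile N T, ∀ k : ℕ, 2 ≤ k →
    ‖apmX A p y₀ (k + 1) - apmX A p y₀ k‖ ≤ ρ * ‖apmX A p y₀ k - apmX A p y₀ (k - 1)‖

/-- `v` is the limit `ν^∞` of the vectors `ν^(k)`. -/
def IsLimitNu {N T : ℕ} (A : Agents N T) (p : Alloc T) (y₀ : Profile N T)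
    (v : Fin T → ℝ) : Prop :=
  ∀ t, Tendsto (fun k => nu p (apmX A p y₀ k) t) atTop (𝓝 (v t))

/-- The parameters of NI-APM other than `ε_cvg`: the norm of the stopping tests, the
threshold constant `B` and the disaggregation tolerance. -/
structure Params (N T : ℕ) where
  norm : Seminorm ℝ (Profile N T)
  B : ℝ
  epsDis : ℝ

/-- A cut `∑_{t ∈ set} p_t ≤ rhs`. -/
structure Cut (T : ℕ) where
  set : Finset (Fin T)
  rhs : ℝ

/-- What NI-APM returns: `Disag = True` with the profile adopted by the agents,
or `Disag = False` with a cut. -/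
inductive Outcome (N T : ℕ) : Type
  | disag (x : Profile N T)
  | cut (c : Cut T)

/-- The resources `{t | B ε < ν_t}` selected by the operator. -/
def selected {T : ℕ} (B ε : ℝ) (ν : Fin T → ℝ) : Finset (Fin T) :=
  open Classical in Finset.univ.filter fun t => B * ε < ν t

/-- The cut `(𝒯, A_𝒯)`, where `𝒯` is the set of selected resources and
`A_𝒯 = ∑_{t ∈ 𝒯} ∑_n x_{n,t}`. -/
def cutOf {N T : ℕ} (B ε : ℝ) (p : Alloc T) (x : Profile N T) : Cut T where
  set := selected B ε (nu p x)
  rhs := ∑ t ∈ selected B ε (nu p x), aggregate x t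

open Classical in
/-- One pass through the loop of NI-APM. The state is the number `k` of alternate projections
already made and the current tolerance `ε`. Iterate `k + 1` is computed; the stopping test
compares it with the previous one, so it can succeed from the second iterate on. If it succeeds,
NI-APM either returns, or goes back to the loop with tolerance `ε / 2`. -/
def niapmStep {N T : ℕ} (A : Agents N T) (par : Params N T) (p : Alloc T) (y₀ : Profile N T)
    (s : ℕ × ℝ) : (ℕ × ℝ) ⊕ Outcome N T :=
  let k := s.1 + 1
  let ε := s.2
  let x := apmX A p y₀ k
  let y := apmY A p y₀ k
  let c := cutOf par.B ε p x
  if 2 ≤ k ∧ par.norm (x - apmX A p y₀ (k - 1)) < ε then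
    if par.norm (x - y) ≤ par.epsDis then .inr (.disag x)
    else if c.rhs - ∑ t ∈ c.set, p t < 0 then .inr (.cut c)
    else .inl (k, ε / 2)
  else .inl (k, ε)

/-- NI-APM, run from a given state, returns the outcome `o` after finitely many steps. -/
inductive NIAPMReturns {N T : ℕ} (A : Agents N T) (par : Params N T) (p : Alloc T)
    (y₀ : Profile N T) : ℕ × ℝ → Outcome N T → Prop
  | ret {s : ℕ × ℝ} {o : Outcome N T} (h : niapmStep A par p y₀ s = .inr o) :
      NIAPMReturns A par p y₀ s o
  | step {s s' : ℕ × ℝ} {o : Outcome N T} (h : niapmStep A par p y₀ s = .inl s')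
      (h' : NIAPMReturns A par p y₀ s' o) : NIAPMReturns A par p y₀ s o

/-- The feasible set `P^(s)` of the master problem: the allocations of `P` that satisfy the
cuts added so far. -/
def masterSet {T : ℕ} (P : Set (Alloc T)) (cuts : List (Cut T)) : Set (Alloc T) :=
  {p | p ∈ P ∧ ∀ c ∈ cuts, ∑ t ∈ c.set, p t ≤ c.rhs}

/-- `master` solves every feasible master problem: it selects a minimizer of `f`.
Its choice may depend on the whole list of cuts. -/
def SolvesMaster {T : ℕ} (P : Set (Alloc T)) (f : Alloc T → ℝ)
    (master : List (Cut T) → Alloc T) : Prop :=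
  ∀ cuts, (masterSet P cuts).Nonempty →
    master cuts ∈ masterSet P cuts ∧ ∀ p ∈ masterSet P cuts, f (master cuts) ≤ f p

/-- `Reaches … cuts`: the optimal disaggregation algorithm, with initial tolerance `ε` for NI-APM,
gets to the beginning of its iteration number `s = cuts.length`, having added to the master problem
the listed cuts, in this order. The starting point of NI-APM is `init cuts`. -/
inductive Reaches {N T : ℕ} (A : Agents N T) (par : Params N T) (ε : ℝ) (P : Set (Alloc T))
    (master : List (Cut T) → Alloc T) (init : List (Cut T) → Profile N T) :
    List (Cut T) → Prop
  | start : Reaches A par ε P master init []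
  | addCut {cuts : List (Cut T)} {c : Cut T} (h : Reaches A par ε P master init cuts)
      (hne : (masterSet P cuts).Nonempty)
      (hc : NIAPMReturns A par (master cuts) (init cuts) (0, ε) (.cut c)) :
      Reaches A par ε P master init (cuts ++ [c])

/-- The iteration that begins with the listed cuts is the last one: the master problem is
infeasible, or NI-APM returns `Disag = True`. -/
def StopsAt {N T : ℕ} (A : Agents N T) (par : Params N T) (ε : ℝ) (P : Set (Alloc T))
    (master : List (Cut T) → Alloc T) (init : List (Cut T) → Profile N T)
    (cuts : List (Cut T)) : Prop :=
  masterSet P cuts = ∅ ∨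
    ((masterSet P cuts).Nonempty ∧
      ∃ x, NIAPMReturns A par (master cuts) (init cuts) (0, ε) (.disag x))

/-- The condition on the tolerance: at every allocation `p^(s)` met by the algorithm,
`2 B ε` is smaller than the least nonzero `|ν^∞_t|`. -/
def ToleranceCond {N T : ℕ} (A : Agents N T) (par : Params N T) (ε : ℝ) (P : Set (Alloc T))
    (master : List (Cut T) → Alloc T) (init : List (Cut T) → Profile N T) : Prop :=
  ∀ cuts, Reaches A par ε P master init cuts → (masterSet P cuts).Nonempty →
    ∀ v, IsLimitNu A (master cuts) (init cuts) v →
      ∀ t, v t ≠ 0 → 2 * par.B * ε < |v t|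

end

end Disaggregation

/-! Convergence factor. The projection on the individual sets is nonexpansive, and `shift` removes
from a difference `d` of profiles its mean over the agents, so it contracts strictly once the
aggregate of `d` controls `d`. For `d = x^(k+1) - x^(k)` it does: by optimality
(`Agents.proj_exchange`) each agent moves mass only towards larger `ν`, so on a suitable upper set
for `ν` the net moves of all agents have the same sign and cannot cancel
(`sq_le_card_mul_sum_sq_of_monotone`).

Cuts. The factor bounds the distance to the limit profile by the last step over `1 - ρ`, so under
the tolerance condition the selected set is exactly `{ν^∞ > 0}` (`IsAPMLimit.selected_eq`). At the
limit no agent can move mass into this set, so every feasible profile aggregates there to less than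
`p`. A cut's right-hand side is the aggregate of a feasible iterate; hence an allocation satisfying
the cut cannot produce the same set again. This needs no tightness of the cut, and bounds their
number.

Small tolerances. The allocations met depend on `ε` through the cuts. With `4Bε` in place of `2Bε`,
the iterate itself is saturated and the cut is determined by its set alone
(`IsAPMLimit.cut_eq_tightCut`). Only finitely many lists of such cuts have distinct sets, so one
bound on `ε` serves them all. -/

namespace Disaggregation

/-! ### Euclidean projection on a complete convex set -/

section EuclProj

variable {F : Type*} [NormedAddCommGroup F] [InnerProductSpace ℝ F]

theorem euclProj_spec {C : Set F} (hne : C.Nonempty) (hc : IsComplete C) (hconv : Convex ℝ C)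
    (y : F) : euclProj C y ∈ C ∧ ∀ z ∈ C, ‖y - euclProj C y‖ ≤ ‖y - z‖ := by
  obtain ⟨v, hv, hmin⟩ := exists_norm_eq_iInf_of_complete_convex hne hc hconv y
  refine Classical.epsilon_spec (p := fun x => x ∈ C ∧ ∀ z ∈ C, ‖y - x‖ ≤ ‖y - z‖) ⟨v, hv, ?_⟩
  intro z hz
  rw [hmin]
  exact ciInf_le (f := fun w : C => ‖y - w‖) ⟨0, by rintro _ ⟨w, rfl⟩; exact norm_nonneg _⟩ ⟨z, hz⟩

theorem inner_sub_euclProj_nonpos {C : Set F} (hne : C.Nonempty) (hc : IsComplete C)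
    (hconv : Convex ℝ C) (y : F) {z : F} (hz : z ∈ C) :
    inner ℝ (y - euclProj C y) (z - euclProj C y) ≤ 0 := by
  obtain ⟨hmem, hmin⟩ := euclProj_spec hne hc hconv y
  refine (norm_eq_iInf_iff_real_inner_le_zero hconv hmem).1 ?_ z hz
  have : Nonempty C := ⟨⟨_, hmem⟩⟩
  exact le_antisymm (le_ciInf fun w => hmin w w.2)
    (ciInf_le (f := fun w : C => ‖y - w‖) ⟨0, by rintro _ ⟨w, rfl⟩; exact norm_nonneg _⟩ ⟨_, hmem⟩)

theorem norm_euclProj_sub_le {C : Set F} (hne : C.Nonempty) (hc : IsComplete C)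
    (hconv : Convex ℝ C) (y y' : F) : ‖euclProj C y - euclProj C y'‖ ≤ ‖y - y'‖ := by
  have h1 := inner_sub_euclProj_nonpos hne hc hconv y (euclProj_spec hne hc hconv y').1
  have h2 := inner_sub_euclProj_nonpos hne hc hconv y' (euclProj_spec hne hc hconv y).1
  generalize euclProj C y = a at *
  generalize euclProj C y' = b at *
  have key : ‖a - b‖ ^ 2 ≤ inner ℝ (y - y') (a - b) := by
    have e : inner ℝ (y - y') (a - b) - inner ℝ (a - b) (a - b)
        = -(inner ℝ (y - a) (b - a)) - inner ℝ (y' - b) (a - b) := by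
      rw [← inner_sub_left, ← neg_sub a b, inner_neg_right, neg_neg, ← inner_sub_left]
      congr 1
      abel
    rw [← real_inner_self_eq_norm_sq]
    linarith
  have hcs := real_inner_le_norm (y - y') (a - b)
  by_contra hlt
  push Not at hlt
  nlinarith [norm_nonneg (y - y'), norm_nonneg (a - b)]

end EuclProj

/-! ### Individual feasibility sets and optimality of the projection -/

variable {N T : ℕ}

theorem Agents.isClosed_feasible (A : Agents N T) (n : Fin N) : IsClosed (A.feasible n) := by
  simp only [Agents.feasible, Set.ofPred_and, Set.ofPred_forall]
  refine IsClosed.inter (isClosed_eq (by fun_prop) continuous_const) (isClosed_iInter fun t => ?_)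
  exact (isClosed_le continuous_const (by fun_prop)).inter
    (isClosed_le (by fun_prop) continuous_const)

theorem Agents.convex_feasible (A : Agents N T) (n : Fin N) : Convex ℝ (A.feasible n) := by
  rintro x ⟨hx, hx'⟩ y ⟨hy, hy'⟩ a b ha hb hab
  refine ⟨?_, fun t => ?_⟩
  · simp only [PiLp.add_apply, PiLp.smul_apply, smul_eq_mul, Finset.sum_add_distrib,
      ← Finset.mul_sum, hx, hy]
    rw [← add_mul, hab, one_mul]
  · simp only [PiLp.add_apply, PiLp.smul_apply, smul_eq_mul]
    have h1 := hx' t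
    have h2 := hy' t
    constructor
    · calc A.lower n t = a * A.lower n t + b * A.lower n t := by rw [← add_mul, hab, one_mul]
        _ ≤ _ := by gcongr <;> [exact h1.1; exact h2.1]
    · calc _ ≤ a * A.upper n t + b * A.upper n t := by gcongr <;> [exact h1.2; exact h2.2]
        _ = _ := by rw [← add_mul, hab, one_mul]

/-- The profiles that satisfy the individual constraints of all the agents. -/
def Agents.feasibleSet (A : Agents N T) : Set (Profile N T) := {x | ∀ n, x n ∈ A.feasible n}

theorem Agents.proj_mem {A : Agents N T} (hA : ∀ n, (A.feasible n).Nonempty) (y : Profile N T) :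
    A.proj y ∈ A.feasibleSet := fun n =>
  (euclProj_spec (hA n) (A.isClosed_feasible n).isComplete (A.convex_feasible n) (y n)).1

theorem Agents.norm_proj_sub_le {A : Agents N T} (hA : ∀ n, (A.feasible n).Nonempty)
    (y y' : Profile N T) : ‖A.proj y - A.proj y'‖ ≤ ‖y - y'‖ := by
  rw [← sq_le_sq₀ (norm_nonneg _) (norm_nonneg _), PiLp.norm_sq_eq_of_L2, PiLp.norm_sq_eq_of_L2]
  refine Finset.sum_le_sum fun n _ => pow_le_pow_left₀ (norm_nonneg _) ?_ 2
  exact norm_euclProj_sub_le (hA n) (A.isClosed_feasible n).isComplete (A.convex_feasible n) _ _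

/-- First order optimality of the projection with respect to transfers between two resources. -/
theorem Agents.proj_exchange {A : Agents N T} (hA : ∀ n, (A.feasible n).Nonempty)
    (y : Profile N T) (n : Fin N) {t s : Fin T} (ht : A.proj y n t < A.upper n t)
    (hs : A.lower n s < A.proj y n s) :
    y n t - A.proj y n t ≤ y n s - A.proj y n s := by
  obtain rfl | hts := eq_or_ne t s
  · exact le_rfl
  have hx := A.proj_mem hA y n
  have hvi := fun z (hz : z ∈ A.feasible n) =>
    inner_sub_euclProj_nonpos (hA n) (A.isClosed_feasible n).isComplete (A.convex_feasible n)
      (y n) hz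
  change ∀ z, z ∈ A.feasible n → inner ℝ (y n - A.proj y n) (z - A.proj y n) ≤ 0 at hvi
  generalize A.proj y n = x at *
  obtain ⟨δ, hδ, hδt, hδs⟩ : ∃ δ > 0, x t + δ ≤ A.upper n t ∧ A.lower n s ≤ x s - δ :=
    ⟨min (A.upper n t - x t) (x s - A.lower n s), lt_min (by linarith) (by linarith),
      by linarith [min_le_left (A.upper n t - x t) (x s - A.lower n s)],
      by linarith [min_le_right (A.upper n t - x t) (x s - A.lower n s)]⟩
  -- Tested on a transfer of `δ` from `s` to `t`, the variational inequality reads `δ * ((y_t - x_t)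
  -- - (y_s - x_s)) ≤ 0`.
  have h := hvi (x + (EuclideanSpace.single t δ - EuclideanSpace.single s δ)) ?_
  · rw [add_sub_cancel_left, inner_sub_right, EuclideanSpace.inner_single_right,
      EuclideanSpace.inner_single_right] at h
    simp only [PiLp.sub_apply, conj_trivial] at h
    nlinarith
  · refine ⟨?_, fun r => ?_⟩
    · simp only [PiLp.add_apply, PiLp.sub_apply, Finset.sum_add_distrib, Finset.sum_sub_distrib]
      simp [PiLp.single_apply, hx.1]
    · have hr := hx.2 r
      simp only [PiLp.add_apply, PiLp.sub_apply, PiLp.single_apply]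
      by_cases h1 : r = t
      · subst h1
        simp only [if_true, if_neg hts]
        constructor <;> linarith
      · by_cases h2 : r = s
        · subst h2
          simp only [if_true, if_neg h1]
          constructor <;> linarith
        · simpa only [if_neg h1, if_neg h2, sub_zero, add_zero] using hr

/-! ### Aggregates, `ν` and the shift -/

theorem Profile.norm_sq_eq (z : Profile N T) : ‖z‖ ^ 2 = ∑ n, ∑ t, z n t ^ 2 := by
  simp only [PiLp.norm_sq_eq_of_L2, Real.norm_eq_abs, sq_abs]

theorem Profile.abs_apply_le (z : Profile N T) (n : Fin N) (t : Fin T) : |z n t| ≤ ‖z‖ :=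
  (PiLp.norm_apply_le (z n) t).trans (PiLp.norm_apply_le z n)

theorem abs_nu_sub_nu_le (p : Alloc T) (x x' : Profile N T) (t : Fin T) :
    |nu p x t - nu p x' t| ≤ ‖x - x'‖ := by
  have e : nu p x t - nu p x' t = (∑ n, (x' - x) n t) / N := by
    simp only [nu, aggregate, PiLp.sub_apply, Finset.sum_sub_distrib]
    ring
  rw [e, abs_div, Nat.abs_cast, norm_sub_rev]
  refine div_le_of_le_mul₀ (Nat.cast_nonneg _) (norm_nonneg _) ?_
  calc |∑ n, (x' - x) n t| ≤ ∑ n, |(x' - x) n t| := Finset.abs_sum_le_sum_abs _ _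
    _ ≤ ∑ _n : Fin N, ‖x' - x‖ := Finset.sum_le_sum fun n _ => Profile.abs_apply_le _ n t
    _ = _ := by simp [mul_comm]

theorem continuous_nu (p : Alloc T) (t : Fin T) :
    Continuous fun x : Profile N T => nu p x t := by
  unfold nu aggregate
  fun_prop

theorem continuous_shift (p : Alloc T) :
    Continuous fun x : Profile N T => shift p x := by
  unfold shift nu aggregate
  fun_prop

theorem Agents.continuous_proj {A : Agents N T} (hA : ∀ n, (A.feasible n).Nonempty) :
    Continuous A.proj :=
  (LipschitzWith.of_dist_le_mul (K := 1) fun y y' => by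
    simpa [dist_eq_norm] using A.norm_proj_sub_le hA y y').continuous

theorem Agents.aggregate_sum {A : Agents N T} {x : Profile N T} (hx : x ∈ A.feasibleSet) :
    ∑ t, aggregate x t = ∑ n, A.demand n := by
  unfold aggregate
  rw [Finset.sum_comm]
  exact Finset.sum_congr rfl fun n _ => (hx n).1

theorem nu_mul_card (hN : 0 < N) (p : Alloc T) (x : Profile N T) (t : Fin T) :
    N * nu p x t = p t - aggregate x t := by
  have : (N : ℝ) ≠ 0 := by positivity
  unfold nu
  field_simp

theorem sum_nu_eq_zero {A : Agents N T} {p : Alloc T} (hp : A.AggregateCond p)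
    {x : Profile N T} (hx : x ∈ A.feasibleSet) : ∑ t, nu p x t = 0 := by
  simp only [nu, ← Finset.sum_div, Finset.sum_sub_distrib, A.aggregate_sum hx, hp.1, sub_self,
    zero_div]

/-- Pythagoras, resource by resource: the shift subtracts from `x - x'` its mean over the agents. -/
theorem norm_shift_sub_shift_sq (hN : 0 < N) (p : Alloc T) (x x' : Profile N T) :
    ‖shift p x - shift p x'‖ ^ 2
      = ‖x - x'‖ ^ 2 - (∑ t, aggregate (x - x') t ^ 2) / N := by
  have hN' : (N : ℝ) ≠ 0 := by positivity
  rw [Profile.norm_sq_eq, Profile.norm_sq_eq, Finset.sum_comm,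
    Finset.sum_comm (f := fun n t => (x - x') n t ^ 2), Finset.sum_div, ← Finset.sum_sub_distrib]
  refine Finset.sum_congr rfl fun t _ => ?_
  have e : ∀ n, (shift p x - shift p x') n t = (x - x') n t - aggregate (x - x') t / N := by
    intro n
    have h : aggregate (x - x') t = aggregate x t - aggregate x' t := by
      simp [aggregate]
    simp only [shift, PiLp.sub_apply, h, nu]
    ring
  simp only [e, sub_sq, Finset.sum_add_distrib, Finset.sum_sub_distrib, ← Finset.sum_mul,
    ← Finset.mul_sum, Finset.sum_const, Finset.card_univ, Fintype.card_fin, nsmul_eq_mul]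
  change _ - 2 * aggregate (x - x') t * _ + _ = _
  field_simp
  ring

/-! ### Existence of a convergence factor -/

/-- Transfers that all go upwards for the order given by `ν` cannot compensate each other. -/
theorem sq_le_card_mul_sum_sq_of_monotone (d : Fin N → Fin T → ℝ) (ν : Fin T → ℝ)
    (hsum : ∀ n, ∑ t, d n t = 0) (hd : ∀ n t s, 0 < d n t → d n s < 0 → ν s < ν t)
    (n : Fin N) (t : Fin T) : d n t ^ 2 ≤ T * ∑ t, (∑ n, d n t) ^ 2 := by
  classical
  -- The upper set for `ν` generated by the resources where agent `n` gains.
  set S : Finset (Fin T) := Finset.univ.filter fun s => ∃ r, 0 < d n r ∧ ν r ≤ ν s with hS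
  have hmem : ∀ s, s ∈ S ↔ ∃ r, 0 < d n r ∧ ν r ≤ ν s := by simp [hS]
  have hcompl : ∀ m, ∑ s ∈ S, d m s = -∑ s ∈ Sᶜ, d m s := fun m => by
    linarith [hsum m, Finset.sum_add_sum_compl S (d m)]
  -- If agent `m` loses somewhere in `S`, all her gains lie higher, hence in `S`; outside `S` she
  -- only loses.
  have hnonneg : ∀ m, 0 ≤ ∑ s ∈ S, d m s := by
    intro m
    by_cases h : ∃ s ∈ S, d m s < 0
    · obtain ⟨s, hs, hneg⟩ := h
      rw [hcompl m, neg_nonneg]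
      refine Finset.sum_nonpos fun r hr => ?_
      by_contra! hpos
      obtain ⟨q, hq, hqs⟩ := (hmem s).1 hs
      exact Finset.mem_compl.1 hr ((hmem r).2 ⟨q, hq, hqs.trans (hd m r s hpos hneg).le⟩)
    · push Not at h
      exact Finset.sum_nonneg h
  -- Agent `n` has all her gains in `S` and no loss there, since a loss must lie strictly below each
  -- of her gains.
  have habs : |d n t| ≤ ∑ s ∈ S, d n s := by
    have hout : ∀ s ∈ Sᶜ, d n s ≤ 0 := fun s hs => by
      by_contra! hpos
      exact Finset.mem_compl.1 hs ((hmem s).2 ⟨s, hpos, le_rfl⟩)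
    have hin : ∀ s ∈ S, 0 ≤ d n s := fun s hs => by
      by_contra! hneg
      obtain ⟨r, hr, hrs⟩ := (hmem s).1 hs
      exact absurd (hd n r s hr hneg) (not_lt.2 hrs)
    by_cases ht : t ∈ S
    · rw [abs_of_nonneg (hin t ht)]
      exact Finset.single_le_sum hin ht
    · have ht' := Finset.mem_compl.2 ht
      rw [abs_of_nonpos (hout t ht'), hcompl n, ← Finset.sum_neg_distrib]
      exact Finset.single_le_sum (f := fun s => -d n s) (fun s hs => by simpa using hout s hs) ht'
  have hle : |d n t| ≤ ∑ s ∈ S, ∑ m, d m s := by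
    rw [Finset.sum_comm]
    exact habs.trans (Finset.single_le_sum (f := fun m => ∑ s ∈ S, d m s)
      (fun m _ => hnonneg m) (Finset.mem_univ n))
  calc d n t ^ 2 = |d n t| ^ 2 := (sq_abs _).symm
    _ ≤ (∑ s ∈ S, ∑ m, d m s) ^ 2 := pow_le_pow_left₀ (abs_nonneg _) hle 2
    _ ≤ S.card * ∑ s ∈ S, (∑ m, d m s) ^ 2 := sq_sum_le_card_mul_sum_sq
    _ ≤ T * ∑ s, (∑ m, d m s) ^ 2 := by
      refine mul_le_mul ?_ ?_ (Finset.sum_nonneg fun _ _ => sq_nonneg _) (Nat.cast_nonneg _)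
      · exact_mod_cast (Finset.card_le_univ S).trans_eq (Fintype.card_fin T)
      · exact Finset.sum_le_univ_sum_of_nonneg fun _ => sq_nonneg _

/-- One alternate projection step moves each agent upwards for `ν`: where a coordinate rose it is
above its lower bound, where it fell it is below its upper bound, so the exchange inequality
compares the two values of `ν`. The constant comes from adding the same bound over `N * T`
coordinates. -/
theorem Agents.norm_proj_shift_sub_sq_le {A : Agents N T} (hA : ∀ n, (A.feasible n).Nonempty)
    (p : Alloc T) {x : Profile N T} (hx : x ∈ A.feasibleSet) :
    ‖A.proj (shift p x) - x‖ ^ 2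
      ≤ N * T ^ 2 * ∑ t, aggregate (A.proj (shift p x) - x) t ^ 2 := by
  have hx' := A.proj_mem hA (shift p x)
  have key := sq_le_card_mul_sum_sq_of_monotone (fun n t => (A.proj (shift p x) - x) n t) (nu p x)
    (fun n => by
      simp only [PiLp.sub_apply, Finset.sum_sub_distrib]
      rw [(hx' n).1, (hx n).1, sub_self])
    (fun n t s ht hs => by
      simp only [PiLp.sub_apply] at ht hs
      have h := A.proj_exchange hA (shift p x) n (t := s) (s := t)
        (by linarith [((hx n).2 s).2]) (by linarith [((hx n).2 t).1])
      simp only [shift] at h ht hs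
      linarith)
  rw [Profile.norm_sq_eq]
  calc _ ≤ ∑ _n : Fin N, ∑ _t : Fin T, T * ∑ t, aggregate (A.proj (shift p x) - x) t ^ 2 :=
        Finset.sum_le_sum fun n _ => Finset.sum_le_sum fun t _ => key n t
    _ = _ := by
      simp only [Finset.sum_const, Finset.card_univ, Fintype.card_fin, nsmul_eq_mul]
      ring

theorem apmX_mem {A : Agents N T} (hA : ∀ n, (A.feasible n).Nonempty) (p : Alloc T)
    (y₀ : Profile N T) (k : ℕ) : apmX A p y₀ (k + 1) ∈ A.feasibleSet :=
  A.proj_mem hA _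

theorem apmX_add_two (A : Agents N T) (p : Alloc T) (y₀ : Profile N T) (k : ℕ) :
    apmX A p y₀ (k + 2) = A.proj (shift p (apmX A p y₀ (k + 1))) := rfl

theorem exists_isAPMRate (hN : 0 < N) (hT : 0 < T) {A : Agents N T}
    (hA : ∀ n, (A.feasible n).Nonempty) (P : Set (Alloc T)) :
    ∃ ρ : ℝ, 0 < ρ ∧ ρ < 1 ∧ IsAPMRate A P ρ := by
  set c : ℝ := ((N : ℝ) ^ 2 * T ^ 2)⁻¹ with hc
  have hN1 : (1 : ℝ) ≤ N := by exact_mod_cast hN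
  have hT1 : (1 : ℝ) ≤ T := by exact_mod_cast hT
  have hc0 : 0 < c := by positivity
  have hc1 : c ≤ 1 := inv_le_one_of_one_le₀ (one_le_mul_of_one_le_of_one_le (one_le_pow₀ hN1)
    (one_le_pow₀ hT1))
  -- The squared contraction factor is `1 - c`; `c` is halved because `c = 1` when `N = T = 1`, and
  -- the factor must be positive.
  refine ⟨√(1 - c / 2), Real.sqrt_pos.2 (by linarith), ?_, ?_⟩
  · rw [Real.sqrt_lt' one_pos]
    linarith
  · intro p _ y₀ k hk
    obtain ⟨k, rfl⟩ := Nat.exists_eq_add_of_le' hk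
    rw [show k + 2 - 1 = k + 1 from rfl, apmX_add_two A p y₀ (k + 1)]
    have h1 := A.norm_proj_shift_sub_sq_le hA p (apmX_mem hA p y₀ k)
    rw [← apmX_add_two] at h1
    have h2 := norm_shift_sub_shift_sq hN p (apmX A p y₀ (k + 2)) (apmX A p y₀ (k + 1))
    have h3 := A.norm_proj_sub_le hA (shift p (apmX A p y₀ (k + 2)))
      (shift p (apmX A p y₀ (k + 1)))
    rw [← apmX_add_two A p y₀ k] at h3
    generalize apmX A p y₀ (k + 2) = a at *
    generalize apmX A p y₀ (k + 1) = b at *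
    rw [← sq_le_sq₀ (norm_nonneg _) (by positivity), mul_pow,
      Real.sq_sqrt (by linarith)]
    refine (pow_le_pow_left₀ (norm_nonneg _) h3 2).trans ?_
    rw [h2]
    have h4 : c * ‖a - b‖ ^ 2 ≤ (∑ t, aggregate (a - b) t ^ 2) / N := by
      rw [hc, inv_mul_le_iff₀ (by positivity)]
      refine h1.trans_eq ?_
      field_simp
    nlinarith [mul_nonneg hc0.le (sq_nonneg ‖a - b‖)]

/-! ### Limit profile and error estimates -/

/-- The limit profile of the alternate projections method, with the error estimates implied by
the convergence factor `ρ`. -/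
structure IsAPMLimit (A : Agents N T) (p : Alloc T) (y₀ : Profile N T) (ρ : ℝ)
    (x : Profile N T) : Prop where
  mem : x ∈ A.feasibleSet
  tendsto : Tendsto (apmX A p y₀) atTop (𝓝 x)
  fixed : A.proj (shift p x) = x
  tail_left : ∀ k, ‖apmX A p y₀ (k + 1) - x‖
    ≤ ‖apmX A p y₀ (k + 2) - apmX A p y₀ (k + 1)‖ / (1 - ρ)
  tail_right : ∀ k, ‖apmX A p y₀ (k + 2) - x‖
    ≤ ‖apmX A p y₀ (k + 2) - apmX A p y₀ (k + 1)‖ / (1 - ρ)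

theorem exists_isAPMLimit {A : Agents N T} (hA : ∀ n, (A.feasible n).Nonempty) {P : Set (Alloc T)}
    {ρ : ℝ} (hρ0 : 0 < ρ) (hρ1 : ρ < 1) (hρ : IsAPMRate A P ρ) {p : Alloc T} (hp : p ∈ P)
    (y₀ : Profile N T) : ∃ x, IsAPMLimit A p y₀ ρ x := by
  -- Indices start at `k + 1` because the value of `apmX` at `0` is not an iterate.
  have hgeom : ∀ k j, dist (apmX A p y₀ (j + (k + 1))) (apmX A p y₀ (j + 1 + (k + 1)))
      ≤ ‖apmX A p y₀ (k + 2) - apmX A p y₀ (k + 1)‖ * ρ ^ j := by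
    intro k j
    induction j with
    | zero =>
      rw [dist_comm, dist_eq_norm, pow_zero, mul_one, zero_add, zero_add, add_comm 1]
    | succ j ih =>
      have h := hρ p hp y₀ (j + 1 + (k + 1)) (by omega)
      rw [show j + 1 + (k + 1) - 1 = j + (k + 1) by omega] at h
      rw [dist_comm, dist_eq_norm] at ih ⊢
      rw [show j + 1 + 1 + (k + 1) = j + 1 + (k + 1) + 1 by ring]
      refine h.trans ((mul_le_mul_of_nonneg_left ih hρ0.le).trans_eq ?_)
      ring
  obtain ⟨x, hx⟩ := cauchySeq_tendsto_of_complete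
    (cauchySeq_of_le_geometric _ _ hρ1 (hgeom 0))
  have hlim : Tendsto (apmX A p y₀) atTop (𝓝 x) := (tendsto_add_atTop_iff_nat 1).1 hx
  have htail : ∀ k, ‖apmX A p y₀ (k + 1) - x‖
      ≤ ‖apmX A p y₀ (k + 2) - apmX A p y₀ (k + 1)‖ / (1 - ρ) := fun k => by
    have h := dist_le_of_le_geometric_of_tendsto₀ _ _ hρ1 (hgeom k)
      ((tendsto_add_atTop_iff_nat (k + 1)).2 hlim)
    rwa [zero_add, dist_eq_norm] at h
  have hfixed : A.proj (shift p x) = x :=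
    tendsto_nhds_unique
      ((((A.continuous_proj hA).comp (continuous_shift p)).tendsto x).comp hx)
      ((tendsto_add_atTop_iff_nat 2).2 hlim)
  refine ⟨x, hfixed ▸ A.proj_mem hA _, hlim, hfixed, htail, fun k => (htail (k + 1)).trans ?_⟩
  have h := hρ p hp y₀ (k + 2) (by omega)
  rw [show k + 2 - 1 = k + 1 from rfl] at h
  have h1 : (0 : ℝ) < 1 - ρ := by linarith
  refine div_le_div_of_nonneg_right (h.trans ?_) h1.le
  exact mul_le_of_le_one_left (norm_nonneg _) hρ1.le

/-- The stopping test of NI-APM bounds the error of the iterates, for the convergence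
factor `ρ`. -/
structure Params.Controls (par : Params N T) (ρ : ℝ) : Prop where
  B_pos : 0 < par.B
  bound : ∀ z ε, 0 < ε → par.norm z < ε → ‖z‖ / (1 - ρ) < par.B * ε
  rho_pos : 0 < ρ
  rho_lt_one : ρ < 1

theorem Params.controls_of_lt (hN : 0 < N) (hT : 0 < T) {par : Params N T} {ρ κ : ℝ}
    (hρ0 : 0 < ρ) (hρ1 : ρ < 1) (hκ : ∀ z, ‖z‖ ≤ κ * par.norm z) (hB : κ / (1 - ρ) < par.B) :
    par.Controls ρ := by
  have h1 : (0 : ℝ) < 1 - ρ := by linarith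
  have hκ0 : 0 < κ := by
    -- A nonzero profile, available because `N` and `T` are positive, forces `κ > 0`.
    set z : Profile N T := WithLp.toLp 2 fun _ => WithLp.toLp 2 fun _ => 1
    have hz : 0 < ‖z‖ := by
      have := Profile.abs_apply_le z ⟨0, hN⟩ ⟨0, hT⟩
      simp only [z, abs_one] at this
      linarith
    exact pos_of_mul_pos_left (hz.trans_le (hκ z)) (apply_nonneg par.norm z)
  refine ⟨(div_pos hκ0 h1).trans hB, fun z ε hε hz => ?_, hρ0, hρ1⟩
  calc ‖z‖ / (1 - ρ) ≤ κ * ε / (1 - ρ) :=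
        div_le_div_of_nonneg_right ((hκ z).trans (mul_le_mul_of_nonneg_left hz.le hκ0.le)) h1.le
    _ = κ / (1 - ρ) * ε := by ring
    _ < par.B * ε := mul_lt_mul_of_pos_right hB hε

/-! ### Selected resources and saturation -/

/-- The resources with a positive component. -/
noncomputable def positiveSet (v : Fin T → ℝ) : Finset (Fin T) :=
  open Classical in Finset.univ.filter fun t => 0 < v t

theorem mem_positiveSet {v : Fin T → ℝ} {t : Fin T} : t ∈ positiveSet v ↔ 0 < v t := by
  simp [positiveSet]

theorem mem_selected {B ε : ℝ} {v : Fin T → ℝ} {t : Fin T} : t ∈ selected B ε v ↔ B * ε < v t := by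
  simp [selected]

/-- If no agent can transfer from outside of `S` into `S`, the aggregate on `S` is maximal. -/
theorem Agents.sum_aggregate_le_of_saturated {A : Agents N T} {x z : Profile N T}
    (hx : x ∈ A.feasibleSet) (hz : z ∈ A.feasibleSet) (S : Finset (Fin T))
    (hS : ∀ n, ∀ t ∈ S, ∀ s ∉ S, x n t < A.upper n t → ¬ A.lower n s < x n s) :
    ∑ t ∈ S, aggregate z t ≤ ∑ t ∈ S, aggregate x t := by
  classical
  unfold aggregate
  rw [Finset.sum_comm, Finset.sum_comm (s := S)]
  refine Finset.sum_le_sum fun n _ => ?_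
  by_cases h : ∃ t ∈ S, x n t < A.upper n t
  · obtain ⟨t, ht, hlt⟩ := h
    have hcompl : ∑ s ∈ Sᶜ, x n s ≤ ∑ s ∈ Sᶜ, z n s := Finset.sum_le_sum fun s hs =>
      (not_lt.1 (hS n t ht s (Finset.mem_compl.1 hs) hlt)).trans ((hz n).2 s).1
    linarith [(hx n).1, (hz n).1, Finset.sum_add_sum_compl S fun s => x n s,
      Finset.sum_add_sum_compl S fun s => z n s]
  · push Not at h
    exact Finset.sum_le_sum fun t ht => ((hz n).2 t).2.trans (h t ht)

theorem sum_aggregate_lt_of_nonempty (hN : 0 < N) {p : Alloc T} {x : Profile N T}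
    (hne : (positiveSet (nu p x)).Nonempty) :
    ∑ t ∈ positiveSet (nu p x), aggregate x t < ∑ t ∈ positiveSet (nu p x), p t := by
  refine Finset.sum_lt_sum_of_nonempty hne fun t ht => ?_
  have h1 := nu_mul_card hN p x t
  have h2 : (0 : ℝ) < N * nu p x t := mul_pos (by exact_mod_cast hN) (mem_positiveSet.1 ht)
  linarith

namespace IsAPMLimit

variable {A : Agents N T} {p : Alloc T} {y₀ x : Profile N T} {ρ : ℝ} {par : Params N T}

theorem isLimitNu (h : IsAPMLimit A p y₀ ρ x) : IsLimitNu A p y₀ (nu p x) := fun t =>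
  ((continuous_nu p t).tendsto x).comp h.tendsto

theorem abs_nu_sub_lt (h : IsAPMLimit A p y₀ ρ x) (hpar : par.Controls ρ) {k : ℕ} {ε : ℝ}
    (hε : 0 < ε) (ht : par.norm (apmX A p y₀ (k + 2) - apmX A p y₀ (k + 1)) < ε) (t : Fin T) :
    |nu p (apmX A p y₀ (k + 1)) t - nu p x t| < par.B * ε ∧
      |nu p (apmX A p y₀ (k + 2)) t - nu p x t| < par.B * ε :=
  ⟨((abs_nu_sub_nu_le p _ _ t).trans (h.tail_left k)).trans_lt (hpar.bound _ _ hε ht),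
    ((abs_nu_sub_nu_le p _ _ t).trans (h.tail_right k)).trans_lt (hpar.bound _ _ hε ht)⟩

/-- The entries of `ν^(k)` are within `Bε` of their limits, which are nonpositive or above `2Bε`;
the threshold `Bε` separates the two cases. -/
theorem selected_eq (h : IsAPMLimit A p y₀ ρ x) (hpar : par.Controls ρ) {k : ℕ} {ε : ℝ}
    (hε : 0 < ε) (ht : par.norm (apmX A p y₀ (k + 2) - apmX A p y₀ (k + 1)) < ε)
    (htol : ∀ t, nu p x t ≠ 0 → 2 * par.B * ε < |nu p x t|) :
    selected par.B ε (nu p (apmX A p y₀ (k + 2))) = positiveSet (nu p x) := by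
  ext t
  rw [mem_selected, mem_positiveSet]
  have h1 := abs_lt.1 (h.abs_nu_sub_lt hpar hε ht t).2
  constructor
  · intro h2
    linarith
  · intro h2
    have h3 := htol t h2.ne'
    rw [abs_of_pos h2] at h3
    linarith

/-- At a fixed point, an agent able to transfer from `s` to `t` must have `ν_t ≤ ν_s`, which is
impossible when `ν_t > 0 ≥ ν_s`. -/
theorem sum_aggregate_le (h : IsAPMLimit A p y₀ ρ x) (hA : ∀ n, (A.feasible n).Nonempty)
    {z : Profile N T} (hz : z ∈ A.feasibleSet) :
    ∑ t ∈ positiveSet (nu p x), aggregate z t ≤ ∑ t ∈ positiveSet (nu p x), aggregate x t := by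
  refine A.sum_aggregate_le_of_saturated h.mem hz _ fun n t ht s hs hup hlow => ?_
  rw [mem_positiveSet] at ht hs
  have hex := A.proj_exchange hA (shift p x) n (t := t) (s := s)
  rw [h.fixed] at hex
  have := hex hup hlow
  simp only [shift] at this
  linarith

/-- The saturation argument at an iterate instead of the limit. Exchange optimality now carries four
errors below `Bε`: the last step and the error of the previous `ν`, each at two resources. Hence the
factor `4`. -/
theorem iterate_sum_aggregate_le (h : IsAPMLimit A p y₀ ρ x)
    (hA : ∀ n, (A.feasible n).Nonempty) (hpar : par.Controls ρ) {k : ℕ} {ε : ℝ}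
    (hε : 0 < ε) (ht : par.norm (apmX A p y₀ (k + 2) - apmX A p y₀ (k + 1)) < ε)
    (htol : ∀ t, nu p x t ≠ 0 → 4 * par.B * ε < |nu p x t|)
    {z : Profile N T} (hz : z ∈ A.feasibleSet) :
    ∑ t ∈ positiveSet (nu p x), aggregate z t
      ≤ ∑ t ∈ positiveSet (nu p x), aggregate (apmX A p y₀ (k + 2)) t := by
  refine A.sum_aggregate_le_of_saturated (apmX_mem hA p y₀ (k + 1)) hz _
    fun n t ht' s hs hup hlow => ?_
  rw [mem_positiveSet] at ht' hs
  have hex := A.proj_exchange hA (shift p (apmX A p y₀ (k + 1))) n hup hlow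
  rw [← apmX_add_two] at hex
  simp only [shift] at hex
  have hd : ∀ r, |(apmX A p y₀ (k + 2) - apmX A p y₀ (k + 1)) n r| < par.B * ε := fun r =>
    ((Profile.abs_apply_le _ n r).trans (le_div_self (norm_nonneg _)
      (by linarith [hpar.rho_lt_one]) (by linarith [hpar.rho_pos]))).trans_lt
      (hpar.bound _ _ hε ht)
  have hdt := abs_lt.1 (hd t)
  have hds := abs_lt.1 (hd s)
  simp only [PiLp.sub_apply] at hdt hds
  have hnt := abs_lt.1 (h.abs_nu_sub_lt hpar hε ht t).1
  have hns := abs_lt.1 (h.abs_nu_sub_lt hpar hε ht s).1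
  have h4 := htol t ht'.ne'
  rw [abs_of_pos ht'] at h4
  linarith

end IsAPMLimit

/-! ### Termination of NI-APM and its cuts -/

/-- NI-APM returns a cut only when its two tests allow it. -/
theorem NIAPMReturns.cut_spec {A : Agents N T} {par : Params N T} {p : Alloc T}
    {y₀ : Profile N T} {s : ℕ × ℝ} {c : Cut T} (h : NIAPMReturns A par p y₀ s (.cut c))
    (hs : 0 < s.2) :
    ∃ k ε, 0 < ε ∧ ε ≤ s.2 ∧ par.norm (apmX A p y₀ (k + 2) - apmX A p y₀ (k + 1)) < ε ∧
      c = cutOf par.B ε p (apmX A p y₀ (k + 2)) ∧ c.rhs < ∑ t ∈ c.set, p t := by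
  generalize ho : Outcome.cut c = o at h
  induction h with
  | @ret s o h =>
    subst ho
    simp only [niapmStep] at h
    split_ifs at h with h1 h2 h3
    · cases h
    · obtain ⟨k, hk⟩ := Nat.exists_eq_add_of_le' (show 1 ≤ s.1 by omega)
      simp only [Sum.inr.injEq, Outcome.cut.injEq] at h
      subst h
      rw [hk] at h1 h3 ⊢
      exact ⟨k, s.2, hs, le_rfl, h1.2, rfl, sub_neg.1 h3⟩
  | @step s s' o h h' ih =>
    have hs' : 0 < s'.2 ∧ s'.2 ≤ s.2 := by
      simp only [niapmStep] at h
      split_ifs at h with h1 h2 h3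
      · cases h
        exact ⟨by dsimp only; linarith, by dsimp only; linarith⟩
      · cases h
        exact ⟨hs, le_rfl⟩
    obtain ⟨k, ε, h1, h2, h3⟩ := ih hs'.1 ho
    exact ⟨k, ε, h1, h2.trans hs'.2, h3⟩

/-- NI-APM returns if its stopping test is eventually satisfied for every tolerance, and if from
some iterate on it returns as soon as this test is satisfied. -/
theorem exists_niapmReturns {A : Agents N T} {par : Params N T} {p : Alloc T} {y₀ : Profile N T}
    (G : ℝ → Prop) (hG : ∀ ε, G ε → G (ε / 2))
    (htest : ∀ ε, G ε → ∀ᶠ k in atTop,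
      par.norm (apmX A p y₀ (k + 2) - apmX A p y₀ (k + 1)) < ε)
    (K : ℕ) (hK : ∀ k ε, K ≤ k → G ε →
      par.norm (apmX A p y₀ (k + 2) - apmX A p y₀ (k + 1)) < ε →
      par.norm (apmX A p y₀ (k + 2) - apmY A p y₀ (k + 2)) ≤ par.epsDis ∨
        (cutOf par.B ε p (apmX A p y₀ (k + 2))).rhs
          < ∑ t ∈ (cutOf par.B ε p (apmX A p y₀ (k + 2))).set, p t)
    {ε : ℝ} (hε : G ε) : ∃ o, NIAPMReturns A par p y₀ (0, ε) o := by
  have hstep : ∀ k ε, G ε → (∃ o, niapmStep A par p y₀ (k, ε) = .inr o) ∨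
      ∃ ε', G ε' ∧ niapmStep A par p y₀ (k, ε) = .inl (k + 1, ε') := by
    intro k ε hε
    simp only [niapmStep]
    split_ifs
    · exact .inl ⟨_, rfl⟩
    · exact .inl ⟨_, rfl⟩
    · exact .inr ⟨_, hG ε hε, rfl⟩
    · exact .inr ⟨_, hε, rfl⟩
  -- Past `K` a successful test makes NI-APM return, so the tolerance is never halved again and a
  -- single use of `htest` suffices.
  have hlate : ∀ k ε, K ≤ k → G ε → (∃ o, niapmStep A par p y₀ (k + 1, ε) = .inr o) ∨
      (niapmStep A par p y₀ (k + 1, ε) = .inl (k + 2, ε) ∧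
        ¬ par.norm (apmX A p y₀ (k + 2) - apmX A p y₀ (k + 1)) < ε) := by
    intro k ε hk hε
    simp only [niapmStep]
    split_ifs with h1 h2 h3
    · exact .inl ⟨_, rfl⟩
    · exact .inl ⟨_, rfl⟩
    · have := hK k ε hk hε h1.2
      exact absurd this (not_or.2 ⟨h2, fun h => h3 (by linarith)⟩)
    · exact .inr ⟨rfl, fun h => h1 ⟨by omega, h⟩⟩
  have hret : ∀ k ε, K ≤ k → G ε → ∃ o, NIAPMReturns A par p y₀ (k + 1, ε) o := by
    intro k ε hk hε
    obtain ⟨M, hM⟩ := eventually_atTop.1 (htest ε hε)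
    obtain ⟨j, hj⟩ : ∃ j, M ≤ k + j := ⟨M, by omega⟩
    induction j generalizing k with
    | zero =>
      obtain ⟨o, ho⟩ | ⟨_, hn⟩ := hlate k ε hk hε
      · exact ⟨o, .ret ho⟩
      · exact absurd (hM k hj) hn
    | succ j ih =>
      obtain ⟨o, ho⟩ | ⟨hs, -⟩ := hlate k ε hk hε
      · exact ⟨o, .ret ho⟩
      · obtain ⟨o, ho⟩ := ih (k + 1) (by omega) (by omega)
        exact ⟨o, .step hs ho⟩
  -- The early passes may halve `ε`, which preserves `G`; `j` bounds the number still to be made.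
  have hearly : ∀ j k ε, K + 1 ≤ k + j → G ε → ∃ o, NIAPMReturns A par p y₀ (k, ε) o := by
    intro j
    induction j with
    | zero =>
      intro k ε hk hε
      obtain ⟨k, rfl⟩ := Nat.exists_eq_add_of_le' (show 1 ≤ k by omega)
      exact hret k ε (by omega) hε
    | succ j ih =>
      intro k ε hk hε
      obtain ⟨o, ho⟩ | ⟨ε', hε', hs⟩ := hstep k ε hε
      · exact ⟨o, .ret ho⟩
      · obtain ⟨o, ho⟩ := ih (k + 1) ε' (by omega) hε'
        exact ⟨o, .step hs ho⟩
  exact hearly (K + 1) 0 ε (by omega) hε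

theorem Params.continuous_norm (par : Params N T) : Continuous par.norm :=
  (ConvexOn.locallyLipschitz par.norm.convexOn).continuous

namespace IsAPMLimit

variable {A : Agents N T} {p : Alloc T} {y₀ x : Profile N T} {ρ : ℝ} {par : Params N T}

theorem eventually_norm_sub_lt (h : IsAPMLimit A p y₀ ρ x) (par : Params N T) {ε : ℝ}
    (hε : 0 < ε) :
    ∀ᶠ k in atTop, par.norm (apmX A p y₀ (k + 2) - apmX A p y₀ (k + 1)) < ε := by
  have h1 := ((tendsto_add_atTop_iff_nat 2).2 h.tendsto).sub
    ((tendsto_add_atTop_iff_nat 1).2 h.tendsto)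
  have h2 := (par.continuous_norm.tendsto _).comp h1
  rw [sub_self, map_zero] at h2
  exact h2.eventually_lt_const hε

theorem exists_niapmReturns (h : IsAPMLimit A p y₀ ρ x) (hN : 0 < N) (hp : A.AggregateCond p)
    (hpar : par.Controls ρ) (hdis : 0 < par.epsDis) {ε : ℝ} (hε : 0 < ε)
    (htol : ∀ t, nu p x t ≠ 0 → 2 * par.B * ε < |nu p x t|) :
    ∃ o, NIAPMReturns A par p y₀ (0, ε) o := by
  let G : ℝ → Prop := fun ε => 0 < ε ∧ ∀ t, nu p x t ≠ 0 → 2 * par.B * ε < |nu p x t|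
  have hG : ∀ ε, G ε → G (ε / 2) := fun ε hε => ⟨half_pos hε.1, fun t ht => by
    have := mul_pos hpar.B_pos hε.1
    linarith [hε.2 t ht]⟩
  have htest := fun ε (hε : G ε) => h.eventually_norm_sub_lt par hε.1
  rcases (positiveSet (nu p x)).eq_empty_or_nonempty with hemp | hne
  -- The entries of `ν^∞` sum to zero, so if none is positive all vanish and `x^(k) - y^(k)` tends
  -- to `0`: the test for "True" eventually succeeds.
  · have hle : ∀ t ∈ Finset.univ, nu p x t ≤ 0 := fun t _ => by
      by_contra! hpos
      exact Finset.notMem_empty t (hemp ▸ mem_positiveSet.2 hpos)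
    have hzero : ∀ t, nu p x t = 0 := fun t =>
      (Finset.sum_eq_zero_iff_of_nonpos hle).1 (sum_nu_eq_zero hp h.mem) t (Finset.mem_univ t)
    have hshift : shift p x = x := by
      ext n t
      simp [shift, hzero]
    have hlim : Tendsto (fun k => par.norm (apmX A p y₀ (k + 2) - apmY A p y₀ (k + 2)))
        atTop (𝓝 0) := by
      have h1 := (tendsto_add_atTop_iff_nat 2).2 h.tendsto
      have h2 := h1.sub (((continuous_shift p).tendsto x).comp h1)
      have h3 := (par.continuous_norm.tendsto _).comp h2
      rw [hshift, sub_self, map_zero] at h3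
      exact h3
    obtain ⟨K, hK⟩ := eventually_atTop.1 (hlim.eventually_lt_const hdis)
    exact Disaggregation.exists_niapmReturns G hG htest K
      (fun k ε hk _ _ => .inl (hK k hk).le) ⟨hε, htol⟩
  -- Here the selected set is nonempty at every successful test, and `ν^(k) > Bε > 0` on it, so the
  -- cut is violated by `p`.
  · refine Disaggregation.exists_niapmReturns G hG htest 0
      (fun k ε _ hε ht => .inr ?_) ⟨hε, htol⟩
    have hsel := h.selected_eq hpar hε.1 ht hε.2
    simp only [cutOf]
    refine Finset.sum_lt_sum_of_nonempty (hsel ▸ hne) fun t ht => ?_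
    have h1 := nu_mul_card hN p (apmX A p y₀ (k + 2)) t
    have h2 : 0 < nu p (apmX A p y₀ (k + 2)) t :=
      (mul_pos hpar.B_pos hε.1).trans (mem_selected.1 ht)
    have h3 : (0 : ℝ) < N * nu p (apmX A p y₀ (k + 2)) t := mul_pos (by exact_mod_cast hN) h2
    linarith

/-- Properties of a cut returned by NI-APM at an allocation that satisfies the previous cuts. -/
theorem cut_properties (h : IsAPMLimit A p y₀ ρ x) (hN : 0 < N)
    (hA : ∀ n, (A.feasible n).Nonempty) (hp : A.AggregateCond p) (hpar : par.Controls ρ) {ε : ℝ}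
    (hε : 0 < ε) (htol : ∀ t, nu p x t ≠ 0 → 2 * par.B * ε < |nu p x t|) {c : Cut T}
    (hc : NIAPMReturns A par p y₀ (0, ε) (.cut c)) :
    c.set ≠ ∅ ∧ c.set ≠ Finset.univ ∧ (∃ z ∈ A.feasibleSet, c.rhs = ∑ t ∈ c.set, aggregate z t) ∧
      ∀ z ∈ A.feasibleSet, ∑ t ∈ c.set, aggregate z t < ∑ t ∈ c.set, p t := by
  obtain ⟨k, ε', hε', hle, ht, rfl, hlt⟩ := hc.cut_spec hε
  have hsel := h.selected_eq hpar hε' ht fun t ht0 =>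
    (mul_le_mul_of_nonneg_left hle (by linarith [hpar.B_pos])).trans_lt (htol t ht0)
  simp only [cutOf, hsel] at hlt ⊢
  have hne : (positiveSet (nu p x)).Nonempty := by
    rw [Finset.nonempty_iff_ne_empty]
    intro hemp
    simp [hemp] at hlt
  refine ⟨hne.ne_empty, fun huniv => ?_, ⟨_, apmX_mem hA p y₀ (k + 1), rfl⟩,
    fun z hz => (h.sum_aggregate_le hA hz).trans_lt (sum_aggregate_lt_of_nonempty hN hne)⟩
  -- On all of `[T]` both sides equal the total demand, so no strict violation is possible.
  rw [huniv, A.aggregate_sum (apmX_mem hA p y₀ (k + 1)), hp.1] at hlt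
  exact lt_irrefl _ hlt

end IsAPMLimit

/-! ### Tight cuts and admissible lists of cuts -/

/-- The cut on `S` that is tight for the aggregates of the feasible profiles. -/
noncomputable def Agents.tightCut (A : Agents N T) (S : Finset (Fin T)) : Cut T where
  set := S
  rhs := sSup ((fun z => ∑ t ∈ S, aggregate z t) '' A.feasibleSet)

theorem IsAPMLimit.cut_eq_tightCut {A : Agents N T} {p : Alloc T} {y₀ x : Profile N T} {ρ : ℝ}
    {par : Params N T} (h : IsAPMLimit A p y₀ ρ x) (hA : ∀ n, (A.feasible n).Nonempty)
    (hpar : par.Controls ρ) {ε : ℝ} (hε : 0 < ε)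
    (htol : ∀ t, nu p x t ≠ 0 → 4 * par.B * ε < |nu p x t|) {c : Cut T}
    (hc : NIAPMReturns A par p y₀ (0, ε) (.cut c)) : c = A.tightCut c.set := by
  obtain ⟨k, ε', hε', hle, ht, rfl, -⟩ := hc.cut_spec hε
  have htol' : ∀ t, nu p x t ≠ 0 → 4 * par.B * ε' < |nu p x t| := fun t ht0 =>
    (mul_le_mul_of_nonneg_left hle (by linarith [hpar.B_pos])).trans_lt (htol t ht0)
  have hsel := h.selected_eq hpar hε' ht fun t ht0 => by
    have := mul_pos hpar.B_pos hε'
    linarith [htol' t ht0]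
  simp only [cutOf, hsel, Agents.tightCut, Cut.mk.injEq, true_and]
  have hmax : IsGreatest
      ((fun z => ∑ t ∈ positiveSet (nu p x), aggregate z t) '' A.feasibleSet)
      (∑ t ∈ positiveSet (nu p x), aggregate (apmX A p y₀ (k + 2)) t) := by
    refine ⟨⟨_, apmX_mem hA p y₀ (k + 1), rfl⟩, ?_⟩
    rintro _ ⟨z, hz, rfl⟩
    exact h.iterate_sum_aggregate_le hA hpar hε' ht htol' hz
  exact hmax.csSup_eq.symm

/-- The cuts are nontrivial, on distinct sets of resources, and each of them is attained by a
feasible profile. -/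
structure Agents.AdmissibleCuts (A : Agents N T) (cuts : List (Cut T)) : Prop where
  nodup : (cuts.map Cut.set).Nodup
  ne : ∀ c ∈ cuts, c.set ≠ ∅ ∧ c.set ≠ Finset.univ
  attained : ∀ c ∈ cuts, ∃ z ∈ A.feasibleSet, c.rhs = ∑ t ∈ c.set, aggregate z t

/-- If the new set were that of an earlier cut, the feasible profile attaining that cut would
aggregate on it to at least `p`, as `p` satisfies the cut, and to strictly less than `p` by
`IsAPMLimit.cut_properties`. -/
theorem Agents.AdmissibleCuts.append {A : Agents N T} {cuts : List (Cut T)}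
    (hcuts : A.AdmissibleCuts cuts) (hA : ∀ n, (A.feasible n).Nonempty) (hN : 0 < N)
    {P : Set (Alloc T)} {p : Alloc T} (hp : A.AggregateCond p) (hpm : p ∈ masterSet P cuts)
    {y₀ x : Profile N T} {ρ : ℝ} (h : IsAPMLimit A p y₀ ρ x) {par : Params N T}
    (hpar : par.Controls ρ) {ε : ℝ} (hε : 0 < ε)
    (htol : ∀ t, nu p x t ≠ 0 → 2 * par.B * ε < |nu p x t|) {c : Cut T}
    (hc : NIAPMReturns A par p y₀ (0, ε) (.cut c)) : A.AdmissibleCuts (cuts ++ [c]) := by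
  obtain ⟨hne, huniv, hatt, hlt⟩ := h.cut_properties hN hA hp hpar hε htol hc
  refine ⟨?_, ?_, ?_⟩
  · rw [List.map_append, List.map_singleton, List.nodup_append_comm, List.singleton_append,
      List.nodup_cons]
    refine ⟨fun hmem => ?_, hcuts.nodup⟩
    obtain ⟨c', hc', heq⟩ := List.mem_map.1 hmem
    obtain ⟨z, hz, hrhs⟩ := hcuts.attained c' hc'
    have h1 := hpm.2 c' hc'
    rw [hrhs, heq] at h1
    exact absurd h1 (not_le.2 (hlt z hz))
  · intro c' hc'
    rcases List.mem_append.1 hc' with h' | h'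
    · exact hcuts.ne c' h'
    · rw [List.mem_singleton.1 h']
      exact ⟨hne, huniv⟩
  · intro c' hc'
    rcases List.mem_append.1 hc' with h' | h'
    · exact hcuts.attained c' h'
    · rwa [List.mem_singleton.1 h']

theorem Agents.AdmissibleCuts.nil (A : Agents N T) : A.AdmissibleCuts [] :=
  ⟨by simp, by simp, by simp⟩

theorem Agents.AdmissibleCuts.length_le {A : Agents N T} {cuts : List (Cut T)}
    (hcuts : A.AdmissibleCuts cuts) (hT : 0 < T) : cuts.length ≤ 2 ^ T - 2 := by
  classical
  have hne : (∅ : Finset (Fin T)) ≠ Finset.univ := fun h =>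
    Finset.notMem_empty (⟨0, hT⟩ : Fin T) (h ▸ Finset.mem_univ _)
  have hsub : (cuts.map Cut.set).toFinset ⊆ Finset.univ \ {∅, Finset.univ} := by
    intro S hS
    obtain ⟨c, hc, rfl⟩ := List.mem_map.1 (List.mem_toFinset.1 hS)
    simpa using hcuts.ne c hc
  have hcard := Finset.card_le_card hsub
  rw [List.toFinset_card_of_nodup hcuts.nodup, List.length_map,
    Finset.card_sdiff_of_subset (Finset.subset_univ _), Finset.card_pair hne, Finset.card_univ,
    Fintype.card_finset, Fintype.card_fin] at hcard
  exact hcard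

/-! ### The optimal disaggregation algorithm -/

section

variable {A : Agents N T} {par : Params N T} {P : Set (Alloc T)} {f : Alloc T → ℝ}
  {master : List (Cut T) → Alloc T} {init : List (Cut T) → Profile N T} {ρ : ℝ}

theorem Reaches.admissibleCuts (hN : 0 < N) (hA : ∀ n, (A.feasible n).Nonempty)
    (hP : ∀ p ∈ P, A.AggregateCond p) (hmaster : SolvesMaster P f master)
    (hpar : par.Controls ρ) (hρ : IsAPMRate A P ρ) {ε : ℝ} (hε : 0 < ε)
    (htol : ToleranceCond A par ε P master init) {cuts : List (Cut T)}
    (h : Reaches A par ε P master init cuts) : A.AdmissibleCuts cuts := by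
  induction h with
  | start => exact .nil A
  | @addCut cuts c h hne hc ih =>
    have hm := (hmaster cuts hne).1
    obtain ⟨x, hx⟩ := exists_isAPMLimit hA hpar.rho_pos hpar.rho_lt_one hρ hm.1 (init cuts)
    exact ih.append hA hN (hP _ hm.1) hm hx hpar hε (htol cuts h hne _ hx.isLimitNu) hc

theorem exists_reaches_stopsAt (hN : 0 < N) (hT : 0 < T) (hA : ∀ n, (A.feasible n).Nonempty)
    (hP : ∀ p ∈ P, A.AggregateCond p) (hmaster : SolvesMaster P f master)
    (hpar : par.Controls ρ) (hρ : IsAPMRate A P ρ) (hdis : 0 < par.epsDis) {ε : ℝ} (hε : 0 < ε)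
    (htol : ToleranceCond A par ε P master init) :
    ∃ cuts, Reaches A par ε P master init cuts ∧ StopsAt A par ε P master init cuts := by
  -- Without a stop every reached iteration adds a cut, so lists of every length are reached,
  -- against `length_le`.
  by_contra! hns
  have hlen : ∀ n, ∃ cuts, Reaches A par ε P master init cuts ∧ cuts.length = n := by
    intro n
    induction n with
    | zero => exact ⟨[], .start, rfl⟩
    | succ n ih =>
      obtain ⟨cuts, h, rfl⟩ := ih
      have hcontinue := hns cuts h
      rw [StopsAt, not_or, ← ne_eq, ← Set.nonempty_iff_ne_empty] at hcontinue
      obtain ⟨hne, hnd⟩ := hcontinue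
      have hm := (hmaster cuts hne).1
      obtain ⟨x, hx⟩ := exists_isAPMLimit hA hpar.rho_pos hpar.rho_lt_one hρ hm.1 (init cuts)
      obtain ⟨o, ho⟩ := hx.exists_niapmReturns hN (hP _ hm.1) hpar hdis hε
        (htol cuts h hne _ hx.isLimitNu)
      cases o with
      | disag z => exact absurd ⟨hne, z, ho⟩ hnd
      | cut c => exact ⟨cuts ++ [c], .addCut h hne ho, by simp⟩
  obtain ⟨cuts, h, hl⟩ := hlen (2 ^ T - 2 + 1)
  have := (h.admissibleCuts hN hA hP hmaster hpar hρ hε htol).length_le hT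
  omega

/-- The lists of tight cuts on distinct sets of resources. -/
def Agents.tightLists (A : Agents N T) : Set (List (Cut T)) :=
  (fun l => l.map A.tightCut) '' {l : List (Finset (Fin T)) | l.Nodup}

theorem Agents.finite_tightLists (A : Agents N T) : A.tightLists.Finite := by
  refine Set.Finite.image _ ((List.finite_length_le _ (Fintype.card (Finset (Fin T)))).subset ?_)
  exact fun l hl => List.Nodup.length_le_card hl

/-- A tolerance small enough for all the lists of tight cuts keeps the algorithm among
these lists. -/
theorem Reaches.mem_tightLists (hN : 0 < N) (hA : ∀ n, (A.feasible n).Nonempty)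
    (hP : ∀ p ∈ P, A.AggregateCond p) (hmaster : SolvesMaster P f master)
    (hpar : par.Controls ρ) (hρ : IsAPMRate A P ρ) {ε : ℝ} (hε : 0 < ε)
    (htol : ∀ cuts ∈ A.tightLists, (masterSet P cuts).Nonempty →
      ∀ v, IsLimitNu A (master cuts) (init cuts) v → ∀ t, v t ≠ 0 → 4 * par.B * ε < |v t|)
    {cuts : List (Cut T)} (h : Reaches A par ε P master init cuts) :
    A.AdmissibleCuts cuts ∧ cuts ∈ A.tightLists := by
  induction h with
  | start => exact ⟨.nil A, [], List.nodup_nil, rfl⟩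
  | @addCut cuts c h hne hc ih =>
    obtain ⟨hadm, hmem⟩ := ih
    have hm := (hmaster cuts hne).1
    obtain ⟨x, hx⟩ := exists_isAPMLimit hA hpar.rho_pos hpar.rho_lt_one hρ hm.1 (init cuts)
    have h4 := htol cuts hmem hne _ hx.isLimitNu
    have hadm' := hadm.append hA hN (hP _ hm.1) hm hx hpar hε (fun t ht => by
      have := mul_pos hpar.B_pos hε
      linarith [h4 t ht]) hc
    refine ⟨hadm', (cuts ++ [c]).map Cut.set, hadm'.nodup, ?_⟩
    obtain ⟨l, -, rfl⟩ := hmem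
    simpa [Function.comp_def, Agents.tightCut] using (hx.cut_eq_tightCut hA hpar hε h4 hc).symm

/-- The condition refers to allocations that depend on `ε`. Imposing the stronger `4Bε` bound on the
finite set `tightLists`, which does not depend on `ε`, removes this circularity. -/
theorem exists_toleranceCond (hN : 0 < N) (hA : ∀ n, (A.feasible n).Nonempty)
    (hP : ∀ p ∈ P, A.AggregateCond p) (hmaster : SolvesMaster P f master)
    (hpar : par.Controls ρ) (hρ : IsAPMRate A P ρ) :
    ∃ ε₀ > 0, ∀ ε, 0 < ε → ε < ε₀ → ToleranceCond A par ε P master init := by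
  have hev : ∀ᶠ ε in 𝓝[>] (0 : ℝ), ∀ cuts ∈ A.tightLists, (masterSet P cuts).Nonempty →
      ∀ v, IsLimitNu A (master cuts) (init cuts) v → ∀ t, v t ≠ 0 → 4 * par.B * ε < |v t| := by
    refine (Filter.eventually_all_finite A.finite_tightLists).2 fun cuts _ => ?_
    -- The limit is unique if it exists, so each list imposes only finitely many conditions on `ε`.
    by_cases hlim : ∃ v, IsLimitNu A (master cuts) (init cuts) v
    · obtain ⟨v, hv⟩ := hlim
      have hcomp : ∀ t, ∀ᶠ ε in 𝓝[>] (0 : ℝ), v t ≠ 0 → 4 * par.B * ε < |v t| := fun t => by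
        by_cases ht : v t = 0
        · exact .of_forall fun _ h => absurd ht h
        · have hcont : Tendsto (fun ε : ℝ => 4 * par.B * ε) (𝓝[>] 0) (𝓝 (4 * par.B * 0)) :=
            (tendsto_id.mono_left nhdsWithin_le_nhds).const_mul _
          rw [mul_zero] at hcont
          exact (hcont.eventually_lt_const (abs_pos.2 ht)).mono fun _ h _ => h
      filter_upwards [Filter.eventually_all.2 hcomp] with ε hε _ w hw
      obtain rfl : w = v := funext fun t => tendsto_nhds_unique (hw t) (hv t)
      exact hε
    · exact .of_forall fun _ _ v hv => absurd ⟨v, hv⟩ hlim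
  obtain ⟨ε₀, hε₀, hsub⟩ := mem_nhdsGT_iff_exists_Ioo_subset.1 hev
  refine ⟨ε₀, hε₀, fun ε h0 h1 cuts hreach hne v hv t ht => ?_⟩
  have htol := hsub ⟨h0, h1⟩
  have h4 := htol cuts (hreach.mem_tightLists hN hA hP hmaster hpar hρ h0 htol).2 hne v hv t ht
  have := mul_pos hpar.B_pos h0
  linarith

end

end Disaggregation

theorem mainTheorem9 {N T : ℕ} (hN : 0 < N) (hT : 0 < T)
    (A : Disaggregation.Agents N T) (hA : ∀ n, (A.feasible n).Nonempty)
    (P : Set (Disaggregation.Alloc T)) (hP : ∀ p ∈ P, A.AggregateCond p) :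
    (∃ ρ : ℝ, 0 < ρ ∧ ρ < 1 ∧ Disaggregation.IsAPMRate A P ρ) ∧
    ∀ (f : Disaggregation.Alloc T → ℝ)
      (master : List (Disaggregation.Cut T) → Disaggregation.Alloc T)
      (init : List (Disaggregation.Cut T) → Disaggregation.Profile N T)
      (par : Disaggregation.Params N T) (ρ κ : ℝ),
      Disaggregation.SolvesMaster P f master →
      0 < ρ → ρ < 1 → Disaggregation.IsAPMRate A P ρ →
      (∀ z, ‖z‖ ≤ κ * par.norm z) → κ / (1 - ρ) < par.B → 0 < par.epsDis →
      (∃ ε₀ > 0, ∀ ε, 0 < ε → ε < ε₀ →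
        Disaggregation.ToleranceCond A par ε P master init) ∧
      ∀ ε, 0 < ε → Disaggregation.ToleranceCond A par ε P master init →
        (∃ cuts, Disaggregation.Reaches A par ε P master init cuts ∧
          Disaggregation.StopsAt A par ε P master init cuts) ∧
        ∀ cuts, Disaggregation.Reaches A par ε P master init cuts →
          cuts.length ≤ 2 ^ T - 2 ∧
          (cuts.map Disaggregation.Cut.set).Nodup ∧
          ∀ c ∈ cuts, c.set ≠ ∅ ∧ c.set ≠ Finset.univ := by
  refine ⟨Disaggregation.exists_isAPMRate hN hT hA P, ?_⟩
  intro f master init par ρ κ hmaster hρ0 hρ1 hρ hκ hB hdis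
  have hpar := Disaggregation.Params.controls_of_lt hN hT hρ0 hρ1 hκ hB
  refine ⟨Disaggregation.exists_toleranceCond hN hA hP hmaster hpar hρ, fun ε hε htol => ⟨?_, ?_⟩⟩
  · exact Disaggregation.exists_reaches_stopsAt hN hT hA hP hmaster hpar hρ hdis hε htol
  · intro cuts h
    have hadm := h.admissibleCuts hN hA hP hmaster hpar hρ hε htol
    exact ⟨hadm.length_le hT, hadm.nodup, hadm.ne⟩
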